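/- Let $K$ be a field. Let $C$ be a coalgebra over $K$ and let $C^*$ be its dual algebra, with the convolution product. A ring is called left (right) semiartinian if it is a semiartinian left (right) module over itself; a module $M$ is semiartinian if its Loewy series terminates at $M$, where $L_0(M)=0$, $L_{\alpha+1}(M)/L_\alpha(M)$ is the socle of $M/L_\alpha(M)$, and $L_\alpha(M)=\bigcup_{\beta<\alpha}L_\beta(M)$ for limit ordinals $\alpha$. Let $C_0\subseteq C_1\subseteq\dots$ be the coradical filtration of $C$, that is, $C_n=L_{n+1}(C)$ for $C$ regarded as a left $C^*$-module via $f\cdot c=\sum f(c_2)c_1$. **(I)** If $C^*$ is left semiartinian, then: 1. $C$ has finite coradical filtration, i.e. $C=C_n$ for some $n\in\mathbb N$; 2. the Jacobson radical $J$ of $C^*$ equals $C_0^\perp=\{f\in C^*: f(C_0)=0\}$, and $J$ is nilpotent; 3. $C^*/J$ is a finite-dimensional semisimple $K$-algebra; 4. $C^*$ is also right semiartinian. **(II)** If $A$ is a profinite $K$-algebra, i.e. the inverse limit of a directed inverse system of finite-dimensional $K$-algebras, and $A$ is left semiartinian, then its Jacobson radical $J$ is nilpotent, $A/J$ is a finite-dimensional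 semisimple $K$-algebra, and $A$ is also right semiartinian. -/

import Mathlib

universe u v w x y

/-! ### The Loewy series and semiartinian modules and rings -/

section Loewy

variable (R : Type u) [Ring R] (M : Type v) [AddCommGroup M] [Module R M]

/-- The socle of a module: the sum of all its simple submodules. -/
def moduleSocle : Submodule R M :=
  sSup {N : Submodule R M | IsSimpleModule R N}

/-- The Loewy series `L_α(M)` of a module: `L_0(M) = 0`, the quotient `L_{α+1}(M) / L_α(M)` is the
socle of `M / L_α(M)`, and `L_α(M)` is the union of the earlier terms if `α` is a limit ordinal
(the series is increasing, so that the union is the supremum of submodules). -/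
noncomputable def loewySeries (α : Ordinal.{v}) : Submodule R M :=
  Ordinal.limitRecOn (motive := fun _ => Submodule R M) α ⊥
    (fun _ L => (moduleSocle R (M ⧸ L)).comap L.mkQ)
    (fun β _ L => ⨆ (γ : Ordinal.{v}) (h : γ < β), L γ h)

theorem loewySeries_zero : loewySeries R M 0 = ⊥ :=
  Ordinal.limitRecOn_zero ..

theorem loewySeries_add_one (α : Ordinal.{v}) :
    loewySeries R M (α + 1) =
      (moduleSocle R (M ⧸ loewySeries R M α)).comap (loewySeries R M α).mkQ :=
  Ordinal.limitRecOn_add_one ..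

theorem loewySeries_limit (α : Ordinal.{v}) (h : Order.IsSuccLimit α) :
    loewySeries R M α = ⨆ (γ : Ordinal.{v}) (_ : γ < α), loewySeries R M γ :=
  Ordinal.limitRecOn_limit _ _ _ _ h

/-- A module is semiartinian if its Loewy series terminates at the whole module. -/
def IsSemiartinianModule : Prop :=
  ∃ α : Ordinal.{v}, loewySeries R M α = ⊤

/-- A ring is left semiartinian if it is semiartinian as a left module over itself. -/
def IsLeftSemiartinianRing : Prop :=
  IsSemiartinianModule R R

/-- A ring is right semiartinian if it is semiartinian as a right module over itself. -/
def IsRightSemiartinianRing : Prop :=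
  IsSemiartinianModule Rᵐᵒᵖ R

end Loewy

/-! ### The dual algebra of a coalgebra and the coradical filtration -/

section Coalgebra

variable (K : Type u) [Field K] (C : Type v) [AddCommGroup C] [Module K C] [Coalgebra K C]

/-- The dual algebra `C^*` of a coalgebra: linear forms on `C` with the convolution product
`(f * g) c = ∑ f c₁ * g c₂`, whose unit is the counit. -/
abbrev DualAlgebra : Type (max u v) := WithConv (C →ₗ[K] K)

/-- The linear map `c ↦ f · c = ∑ f c₂ • c₁`. -/
noncomputable def dualAction (f : C →ₗ[K] K) : C →ₗ[K] C :=
  (TensorProduct.rid K C).toLinearMap ∘ₗ f.lTensor C ∘ₗ Coalgebra.comul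

variable {K C} in
theorem dualAction_apply {ι : Type*} {c : C} (r : Coalgebra.Repr K c ι) (f : C →ₗ[K] K) :
    dualAction K C f c = ∑ i ∈ r.index, f (r.right i) • r.left i := by
  simp [dualAction, ← r.eq]

/-- `C`, as a right comodule over itself, is a left module over its dual algebra, with
`f · c = ∑ f c₂ • c₁`. -/
noncomputable instance dualModule : Module (DualAlgebra K C) C where
  smul f c := dualAction K C f.ofConv c
  one_smul c := by
    change dualAction K C (Algebra.linearMap K K ∘ₗ Coalgebra.counit) c = c
    simp [dualAction]
  mul_smul f g c := by
    let r := Coalgebra.Repr.arbitrary K c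
    let s := fun i => Coalgebra.Repr.arbitrary K (r.left i)
    let t := fun i => Coalgebra.Repr.arbitrary K (r.right i)
    change dualAction K C (f * g).ofConv c = dualAction K C f.ofConv (dualAction K C g.ofConv c)
    have key := congrArg ((TensorProduct.rid K C).toLinearMap ∘ₗ TensorProduct.map LinearMap.id
      (LinearMap.mul' K K ∘ₗ TensorProduct.map f.ofConv g.ofConv))
      (Coalgebra.sum_tmul_tmul_eq r s t)
    rw [dualAction_apply r, dualAction_apply r, map_sum]
    simp only [map_smul, fun i => dualAction_apply (s i) f.ofConv]
    simp only [map_sum, LinearMap.comp_apply, TensorProduct.map_tmul, LinearMap.id_apply,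
      LinearMap.mul'_apply, LinearEquiv.coe_coe, TensorProduct.rid_tmul] at key
    simp only [fun i => (t i).convMul_apply f g, Finset.sum_smul, Finset.smul_sum, smul_smul]
    rw [← key]
    simp only [mul_comm]
  smul_zero f := map_zero _
  smul_add f := map_add _
  add_smul f g c := by
    change dualAction K C (f.ofConv + g.ofConv) c = _
    simp [dualAction, LinearMap.lTensor_add]
    rfl
  zero_smul c := by
    change dualAction K C 0 c = _
    simp [dualAction]

/-- The `n`-th term `C_n` of the coradical filtration of `C`, that is, the term `L_{n+1}` of the
Loewy series of `C` as a left `C^*`-module. In particular `C_0` is the socle of `C`. -/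
noncomputable def coradicalFiltration (n : ℕ) : Submodule (DualAlgebra K C) C :=
  loewySeries (DualAlgebra K C) C ((n : Ordinal.{v}) + 1)

/-- `C` has finite coradical filtration if `C = C_n` for some `n`. -/
def HasFiniteCoradicalFiltration : Prop :=
  ∃ n : ℕ, coradicalFiltration K C n = ⊤

end Coalgebra

/-! ### Profinite algebras -/

/-- The algebra `A`, with the projections `π i : A → F i`, is the inverse limit of the system of
algebras `F i` with transition maps `t : F j → F i` for `i ≤ j`. -/
structure IsInverseLimitAlgebra {K : Type u} [Field K] {ι : Type x} [Preorder ι]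
    {F : ι → Type w} [∀ i, Ring (F i)] [∀ i, Algebra K (F i)]
    (t : ∀ ⦃i j : ι⦄, i ≤ j → F j →ₐ[K] F i)
    {A : Type v} [Ring A] [Algebra K A] (π : ∀ i, A →ₐ[K] F i) : Prop where
  compatible : ∀ ⦃i j : ι⦄ (h : i ≤ j) (a : A), t h (π j a) = π i a
  existsUnique : ∀ y : ∀ i, F i, (∀ ⦃i j : ι⦄ (h : i ≤ j), t h (y j) = y i) →
    ∃! a : A, ∀ i, π i a = y i

/-! ### Socles, Loewy series and the Jacobson radical -/

section Loewy

variable {R : Type u} [Ring R] {M : Type v} [AddCommGroup M] [Module R M]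

/-! Both parts concern an algebra `A` that is the dual space of an `A`-bimodule `W` through a form
`ε`, where `W` is locally finite on the right (`IsPredual`). For `C^*` take `C` with its counit; for
an inverse limit take the forms that factor through a projection, with evaluation at `1`.

Let `S` be the right socle of `W` and `J` the Jacobson radical of `A`. Local finiteness makes `S`
meet every nonzero right submodule, whence `J` is the set of forms vanishing on `S`
(`mem_jacobson_iff`). Forms extend from `S` to `W`, so `A` maps onto `End S`. If `S` were not
finitely generated, the elements acting on it with finitely generated range would form a proper
ideal `F` with `A / F` of zero socle, which a semiartinian ring forbids
(`finite_of_isLeftSemiartinianRing_of_surjective_toEnd`). So `S` is finite-dimensional, and `A / J`,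
embedded in the dual of `S`, is finite-dimensional and semisimple.

If `J ^ n * x` is nonzero for every `n`, the same holds for `a * x` with some `a` in `J`
(`exists_jacobson_mul`). Were `J` not nilpotent, this could be iterated forever from `x = 1`, while
each step descends in the Loewy series of `A`. Once `J` is nilpotent with semisimple quotient, all
left and right modules have finite Loewy series. -/

theorem isSemisimpleModule_moduleSocle : IsSemisimpleModule R (moduleSocle R M) := by
  rw [moduleSocle, sSup_eq_iSup]
  exact isSemisimpleModule_biSup_of_isSemisimpleModule_submodule
    (s := {N : Submodule R M | IsSimpleModule R N}) (p := id)
    fun N (hN : IsSimpleModule R N) => inferInstanceAs (IsSemisimpleModule R N)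

theorem le_moduleSocle_of_isSemisimpleModule (N : Submodule R M) [IsSemisimpleModule R N] :
    N ≤ moduleSocle R M := by
  have h := IsSemisimpleModule.sSup_simples_eq_top R N
  rw [← N.range_subtype, LinearMap.range_eq_map, ← h, Submodule.map_le_iff_le_comap]
  refine sSup_le fun S (hS : IsSimpleModule R S) => ?_
  rw [← Submodule.map_le_iff_le_comap]
  exact le_sSup (IsSimpleModule.congr (N.equivSubtypeMap S).symm)

theorem map_moduleSocle_le {M' : Type w} [AddCommGroup M'] [Module R M'] (f : M →ₗ[R] M') :
    (moduleSocle R M).map f ≤ moduleSocle R M' := by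
  have := isSemisimpleModule_moduleSocle (R := R) (M := M)
  have h : IsSemisimpleModule R ((moduleSocle R M).map f) := by
    rw [← Submodule.range_subtype (moduleSocle R M), ← LinearMap.range_comp]
    exact IsSemisimpleModule.range _
  exact le_moduleSocle_of_isSemisimpleModule _

theorem smul_eq_zero_of_mem_moduleSocle {a : R} (ha : a ∈ Ring.jacobson R) {m : M}
    (hm : m ∈ moduleSocle R M) : a • m = 0 := by
  have := isSemisimpleModule_moduleSocle (R := R) (M := M)
  have h := IsSemisimpleModule.jacobson_le_annihilator R (moduleSocle R M) ha
  exact congrArg Subtype.val (Module.mem_annihilator.mp h ⟨m, hm⟩)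

theorem loewySeries_mono : Monotone (loewySeries R M) := by
  intro α β
  induction β using Ordinal.limitRecOn with
  | zero => intro h; rw [le_antisymm h bot_le]
  | add_one β ih =>
    intro h
    rcases h.lt_or_eq with h | rfl
    · refine (ih (Order.lt_add_one_iff.mp h)).trans ?_
      rw [loewySeries_add_one]
      intro m hm
      rw [Submodule.mem_comap, Submodule.mkQ_apply, (Submodule.Quotient.mk_eq_zero _).mpr hm]
      exact zero_mem _
    · rfl
  | limit β hβ ih =>
    intro h
    rcases h.lt_or_eq with h | rfl
    · rw [loewySeries_limit R M β hβ]
      exact le_iSup₂_of_le α h le_rfl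
    · rfl

theorem exists_lt_mem_loewySeries_of_isSuccLimit {β : Ordinal.{v}} (hβ : Order.IsSuccLimit β)
    {m : M} (hm : m ∈ loewySeries R M β) : ∃ γ < β, m ∈ loewySeries R M γ := by
  rw [loewySeries_limit R M β hβ, iSup_subtype'] at hm
  have : Nonempty {γ : Ordinal.{v} // γ < β} := ⟨⟨0, hβ.bot_lt⟩⟩
  rw [Submodule.mem_iSup_of_directed] at hm
  · obtain ⟨γ, hγ⟩ := hm
    exact ⟨γ, γ.2, hγ⟩
  · exact (loewySeries_mono.comp (Subtype.mono_coe _)).directed_le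

/-- If `L_α ≤ N`, the socle of `M / L_α` maps into the socle of `M / N`, which is zero; so the
series can never leave `N`. -/
theorem loewySeries_le_of_moduleSocle_quotient_eq_bot {N : Submodule R M}
    (hN : moduleSocle R (M ⧸ N) = ⊥) (α : Ordinal.{v}) : loewySeries R M α ≤ N := by
  induction α using Ordinal.limitRecOn with
  | zero => rw [loewySeries_zero]; exact bot_le
  | add_one α ih =>
    intro m hm
    rw [loewySeries_add_one, Submodule.mem_comap] at hm
    have h := map_moduleSocle_le (Submodule.factor ih) (Submodule.mem_map_of_mem hm)
    rw [hN, Submodule.mem_bot] at h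
    simpa using h
  | limit α hα ih =>
    rw [loewySeries_limit R M α hα]
    exact iSup₂_le ih

/-- A proper quotient of a semiartinian module has a nonzero socle. -/
theorem IsSemiartinianModule.moduleSocle_quotient_ne_bot (h : IsSemiartinianModule R M)
    {N : Submodule R M} (hN : N ≠ ⊤) : moduleSocle R (M ⧸ N) ≠ ⊥ := by
  intro hs
  obtain ⟨α, hα⟩ := h
  exact hN (top_le_iff.mp (hα ▸ loewySeries_le_of_moduleSocle_quotient_eq_bot hs α))

/-- A transfinite form of the `T`-nilpotency of the Jacobson radical on semiartinian modules. -/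
theorem IsSemiartinianModule.not_of_jacobson_smul (hM : IsSemiartinianModule R M) {P : M → Prop}
    (h0 : ¬ P 0) (h : ∀ m, P m → ∃ a ∈ Ring.jacobson R, P (a • m)) (m : M) : ¬ P m := by
  obtain ⟨α, hα⟩ := hM
  suffices H : ∀ α, ∀ m ∈ loewySeries R M α, ¬ P m from H α m (hα ▸ Submodule.mem_top)
  intro α
  induction α using Ordinal.limitRecOn with
  | zero =>
    intro m hm
    rw [loewySeries_zero, Submodule.mem_bot] at hm
    rwa [hm]
  | add_one α ih =>
    intro m hm hP
    obtain ⟨a, ha, hPa⟩ := h m hP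
    rw [loewySeries_add_one, Submodule.mem_comap] at hm
    -- The radical kills the socle of `M / L_α`, so `a • m` already lies in `L_α`.
    refine ih (a • m) ?_ hPa
    have := smul_eq_zero_of_mem_moduleSocle ha hm
    rw [← map_smul] at this
    exact (Submodule.Quotient.mk_eq_zero _).mp this
  | limit α hα ih =>
    intro m hm
    obtain ⟨γ, hγ, hm⟩ := exists_lt_mem_loewySeries_of_isSuccLimit hα hm
    exact ih γ hγ m hm

/-- The elements killed by `I` form a module over the semisimple ring `R ⧸ I`, hence a semisimple
submodule. -/
theorem mem_moduleSocle_of_forall_smul_eq_zero (I : Ideal R) [I.IsTwoSided]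
    [IsSemisimpleRing (R ⧸ I)] {m : M} (hm : ∀ a ∈ I, a • m = 0) : m ∈ moduleSocle R M := by
  let T : Submodule R M :=
    { carrier := {m | ∀ a ∈ I, a • m = 0}
      add_mem' := fun {x y} hx hy a ha => by rw [smul_add, hx a ha, hy a ha, add_zero]
      zero_mem' := fun a _ => smul_zero a
      smul_mem' := fun r x hx a ha => by rw [smul_smul]; exact hx _ (I.mul_mem_right r ha) }
  have hT : Module.IsTorsionBySet R T I := fun x a => Subtype.ext (x.2 a a.2)
  let _ := hT.module
  have hs : IsSemisimpleModule R T :=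
    (hT.isSemisimpleModule_iff).mp inferInstance
  exact le_moduleSocle_of_isSemisimpleModule T hm

/-- Over a ring with a nilpotent ideal modulo which it is semisimple, all modules have a finite
Loewy series. -/
theorem loewySeries_eq_top_of_pow_eq_bot (I : Ideal R) [I.IsTwoSided] [IsSemisimpleRing (R ⧸ I)]
    {n : ℕ} (hI : I ^ n = ⊥) : loewySeries R M n = ⊤ := by
  -- Stronger claim, suited to induction: whatever `I ^ n` kills lies in `L_n`.
  suffices H : ∀ n : ℕ, ∀ m : M, (∀ a ∈ I ^ n, a • m = 0) → m ∈ loewySeries R M n from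
    top_le_iff.mp fun m _ => H n m fun a ha => by
      rw [hI, Submodule.mem_bot] at ha
      rw [ha, zero_smul]
  intro n
  induction n with
  | zero =>
    intro m hm
    have := hm 1 (by rw [Submodule.pow_zero, Ideal.one_eq_top]; trivial)
    rw [one_smul] at this
    rw [this]
    exact zero_mem _
  | succ n ih =>
    intro m hm
    rw [Nat.cast_succ, loewySeries_add_one, Submodule.mem_comap]
    refine mem_moduleSocle_of_forall_smul_eq_zero I fun a ha => ?_
    rw [← map_smul]
    refine (Submodule.Quotient.mk_eq_zero _).mpr (ih _ fun b hb => ?_)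
    rw [smul_smul]
    exact hm _ (by rw [Submodule.pow_succ]; exact Ideal.mul_mem_mul hb ha)

theorem pow_comap_mulOpposite_le (J : Ideal R) [J.IsTwoSided] (I : Ideal Rᵐᵒᵖ)
    (hI : ∀ a ∈ I, a.unop ∈ J) (n : ℕ) : ∀ a ∈ I ^ n, a.unop ∈ J ^ n := by
  induction n with
  | zero => intro a _; rw [Submodule.pow_zero, Ideal.one_eq_top]; trivial
  | succ n ih =>
    intro a ha
    rw [Submodule.pow_succ] at ha
    induction ha using Submodule.mul_induction_on' with
    | mem_mul_mem r hr s hs =>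
      -- `unop` reverses products, so the new factor must be split off on the left.
      rw [MulOpposite.unop_mul, Ideal.IsTwoSided.pow_succ]
      exact Ideal.mul_mem_mul (hI s hs) (ih r hr)
    | add r hr s hs h1 h2 => exact add_mem h1 h2

/-- A semiprimary ring is right semiartinian. -/
theorem isRightSemiartinianRing_of_isNilpotent_jacobson (h : IsNilpotent (Ring.jacobson R))
    (hs : IsSemisimpleRing (R ⧸ Ring.jacobson R)) : IsRightSemiartinianRing R := by
  obtain ⟨n, hn⟩ := h
  let f : Rᵐᵒᵖ →+* (R ⧸ Ring.jacobson R)ᵐᵒᵖ := (Ideal.Quotient.mk (Ring.jacobson R)).op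
  have hf : Function.Surjective f := fun x => by
    obtain ⟨a, ha⟩ := Ideal.Quotient.mk_surjective x.unop
    exact ⟨MulOpposite.op a, MulOpposite.unop_injective ha⟩
  have hq : IsSemisimpleRing (Rᵐᵒᵖ ⧸ RingHom.ker f) :=
    (RingHom.quotientKerEquivOfSurjective hf).symm.isSemisimpleRing
  refine ⟨n, loewySeries_eq_top_of_pow_eq_bot (RingHom.ker f) (le_bot_iff.mp fun a ha => ?_)⟩
  have := pow_comap_mulOpposite_le (Ring.jacobson R) (RingHom.ker f) (fun a ha => by
    rw [RingHom.mem_ker] at ha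
    exact Ideal.Quotient.eq_zero_iff_mem.mp (congrArg MulOpposite.unop ha)) n a ha
  rw [hn] at this
  exact MulOpposite.unop_injective this

theorem isUnit_one_add_of_mem_jacobson {a : R} (ha : a ∈ Ring.jacobson R) : IsUnit (1 + a) := by
  have key : ∀ b ∈ Ring.jacobson R, ∃ c, c * (1 + b) = 1 := fun b hb => by
    rw [← Ideal.jacobson_bot, Ideal.mem_jacobson_iff] at hb
    obtain ⟨z, hz⟩ := hb 1
    refine ⟨z, ?_⟩
    rw [Submodule.mem_bot, mul_one] at hz
    rw [mul_add, mul_one, add_comm]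
    exact sub_eq_zero.mp hz
  obtain ⟨c, hc⟩ := key a ha
  -- The left inverse satisfies `c = 1 - c * a`, so it has a left inverse too and is therefore
  -- two-sided.
  obtain ⟨d, hd⟩ := key (-(c * a)) (neg_mem (Ideal.mul_mem_left _ c ha))
  have hc' : 1 + -(c * a) = c := by rw [← hc]; noncomm_ring
  rw [hc'] at hd
  have : d = 1 + a := left_inv_eq_right_inv hd hc
  exact ⟨⟨1 + a, c, this ▸ hd, hc⟩, rfl⟩

/-- The Jacobson radical, defined by maximal left ideals, annihilates the socles of right
modules. -/
theorem op_smul_eq_zero_of_mem_moduleSocle {N : Type w} [AddCommGroup N] [Module Rᵐᵒᵖ N] {a : R}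
    (ha : a ∈ Ring.jacobson R) {m : N} (hm : m ∈ moduleSocle Rᵐᵒᵖ N) :
    MulOpposite.op a • m = 0 := by
  suffices H : moduleSocle Rᵐᵒᵖ N ≤
      { carrier := {m | ∀ a ∈ Ring.jacobson R, MulOpposite.op a • m = 0}
        add_mem' := fun {x y} hx hy a ha => by rw [smul_add, hx a ha, hy a ha, add_zero]
        zero_mem' := fun a _ => smul_zero _
        smul_mem' := fun r x hx a ha => by
          rw [smul_smul]; exact hx (r.unop * a) (Ideal.mul_mem_left _ _ ha) } from H hm a ha
  refine sSup_le fun S (hS : IsSimpleModule Rᵐᵒᵖ S) s hs a ha => ?_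
  by_contra hne
  have hne' : (MulOpposite.op a • (⟨s, hs⟩ : S)) ≠ 0 := fun h => hne (congrArg Subtype.val h)
  -- By simplicity `s a r = -s` for some `r`; then the unit `1 + a r` kills `s`.
  obtain ⟨r, hr⟩ := IsSimpleModule.toSpanSingleton_surjective Rᵐᵒᵖ hne' (-⟨s, hs⟩)
  have hr : r • MulOpposite.op a • s = -s := congrArg Subtype.val hr
  obtain ⟨u, hu⟩ := isUnit_one_add_of_mem_jacobson
    (Ideal.IsTwoSided.mul_mem_of_left r.unop ha)
  have h0 : MulOpposite.op (u : R) • s = 0 := by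
    rw [hu, MulOpposite.op_add, add_smul, MulOpposite.op_one, one_smul, MulOpposite.op_mul,
      mul_smul, MulOpposite.op_unop, hr, add_neg_cancel]
  have hs0 : s = 0 := by
    have := congrArg (MulOpposite.op (↑u⁻¹ : R) • ·) h0
    simpa only [smul_smul, ← MulOpposite.op_mul, Units.mul_inv, MulOpposite.op_one, one_smul,
      smul_zero] using this
  exact hne (by rw [hs0, smul_zero])

end Loewy

/-! ### Endomorphisms of semisimple modules and ranges of finite length -/

section EndomorphismRing

variable {R : Type u} [Ring R] {S : Type v} [AddCommGroup S] [Module R S]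

theorem Submodule.FG.of_le_of_isSemisimpleModule [IsSemisimpleModule R S] {N N' : Submodule R S}
    (h : N ≤ N') (hN' : N'.FG) : N.FG := by
  have : Module.Finite R N' := Module.Finite.iff_fg.mpr hN'
  exact isNoetherian_submodule.mp (inferInstanceAs (IsNoetherian R N')) N h

/-- Finite generation is compactness: the supremum would lie below that of a finite subfamily, and
any further member of `t` would contradict independence. -/
theorem not_fg_sSup_of_infinite_of_sSupIndep {s t : Set (Submodule R S)} (hs : sSupIndep s)
    (hne : ∀ a ∈ s, a ≠ ⊥) (hts : t ⊆ s) (ht : t.Infinite) : ¬ (sSup t).FG := by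
  intro h
  rw [Submodule.fg_iff_compact,
    CompleteLattice.isCompactElement_iff_exists_le_sSup_of_le_sSup] at h
  obtain ⟨t₀, ht₀, hle⟩ := h t le_rfl
  obtain ⟨x, hxt, hx⟩ := ht.exists_notMem_finset t₀
  refine hne x (hts hxt) (disjoint_self.mp ((hs (hts hxt)).mono_right ?_))
  refine (le_sSup hxt).trans (hle.trans ?_)
  rw [Finset.sup_id_eq_sSup]
  refine sSup_le_sSup fun y hy => ⟨hts (ht₀ hy), ?_⟩
  rintro rfl
  exact hx hy

/-- A semisimple module that is not finitely generated splits into two such parts. -/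
theorem exists_isCompl_not_fg [IsSemisimpleModule R S] {N : Submodule R S} (hN : ¬ N.FG) :
    ∃ U V : Submodule R S, IsCompl U V ∧ U ≤ N ∧ ¬ U.FG ∧ ¬ (N ⊓ V).FG := by
  obtain ⟨s, hs, hsN, hat⟩ := exists_sSupIndep_of_sSup_atoms N
    ((congrArg sSup (Set.ext fun _ => and_comm)).trans (sSup_atoms_le_eq N))
  have hinf : s.Infinite := fun hfin => hN <| by
    rw [← hsN, sSup_eq_iSup]
    refine Submodule.fg_biSup hfin.toFinset id (fun a ha => ?_) |> cast (by simp)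
    have : IsSimpleModule R a := isSimpleModule_iff_isAtom.mpr (hat (by simpa using ha))
    exact Module.Finite.iff_fg.mp (inferInstanceAs (Module.Finite R a))
  -- An infinite independent family of simple submodules is halved. `U` is the sum of one half, and
  -- `V` is a complement of `U` containing the other.
  obtain ⟨t, t', htt', hdisj, hcard⟩ := hinf.exists_union_disjoint_cardinal_eq_of_infinite
  have ht : t.Infinite ∧ t'.Infinite := by
    have h : t.Infinite ↔ t'.Infinite := by
      rw [← Set.infinite_coe_iff, ← Set.infinite_coe_iff, Cardinal.infinite_iff,
        Cardinal.infinite_iff, hcard]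
    rw [← htt', Set.infinite_union] at hinf
    tauto
  have hts : t ⊆ s := htt' ▸ Set.subset_union_left
  have hts' : t' ⊆ s := htt' ▸ Set.subset_union_right
  have hd : Disjoint (sSup t) (sSup t') := by
    have h := ((sSupIndep_iff s).mp hs).disjoint_biSup_biSup (hdisj.preimage Subtype.val)
    have himg : ∀ r ⊆ s, ⨆ i ∈ (Subtype.val ⁻¹' r : Set s), (i : Submodule R S) = sSup r :=
      fun r hr => by
        rw [← sSup_image, Subtype.image_preimage_coe, Set.inter_eq_right.mpr hr]
    rwa [himg t hts, himg t' hts'] at h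
  obtain ⟨V, hV, hc⟩ := hd.symm.exists_isCompl
  refine ⟨sSup t, V, hc.symm, hsN ▸ sSup_le_sSup hts,
    not_fg_sSup_of_infinite_of_sSupIndep hs (fun a ha => (hat ha).1) hts ht.1, fun h => ?_⟩
  exact not_fg_sSup_of_infinite_of_sSupIndep hs (fun a ha => (hat ha).1) hts' ht.2
    (h.of_le_of_isSemisimpleModule (le_inf (hsN ▸ sSup_le_sSup hts') hV))

/-- A semisimple module is finitely generated if its endomorphism ring is a quotient of a left
semiartinian ring. -/
theorem finite_of_isLeftSemiartinianRing_of_surjective_toEnd [IsSemisimpleModule R S]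
    {A : Type w} [Ring A] (hA : IsLeftSemiartinianRing A) (ρ : A →+* Module.End R S)
    (hρ : Function.Surjective ρ) : Module.Finite R S := by
  by_contra hS
  let F : Ideal A :=
    { carrier := {a | (LinearMap.range (ρ a)).FG}
      add_mem' := fun {a b} ha hb => by
        refine (ha.sup hb).of_le_of_isSemisimpleModule ?_
        rw [map_add]
        exact LinearMap.range_add_le _ _
      zero_mem' := by
        change (LinearMap.range (ρ 0)).FG
        rw [map_zero, LinearMap.range_zero]
        exact Submodule.fg_bot
      smul_mem' := fun c a ha => by
        change (LinearMap.range (ρ (c * a))).FG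
        rw [map_mul, Module.End.mul_eq_comp, LinearMap.range_comp]
        exact ha.map _ }
  have hF : F ≠ ⊤ := fun h => hS <| by
    have h1 : (LinearMap.range (ρ 1)).FG := (Ideal.eq_top_iff_one F).mp h
    rw [map_one, Module.End.one_eq_id, LinearMap.range_id] at h1
    exact ⟨h1⟩
  refine hA.moduleSocle_quotient_ne_bot hF (sSup_eq_bot.mpr fun T (hT : IsSimpleModule A T) => ?_)
  by_contra hTne
  obtain ⟨q, hqT, hq⟩ := Submodule.exists_mem_ne_zero_of_ne_bot hTne
  obtain ⟨a, rfl⟩ := F.mkQ_surjective q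
  have haF : ¬ (LinearMap.range (ρ a)).FG := fun h => hq ((Submodule.Quotient.mk_eq_zero F).mpr h)
  obtain ⟨U, V, hUV, hUN, hU, hV⟩ := exists_isCompl_not_fg haF
  -- `e` acts as the projection onto one half of the range of `a`, so `e * a` still has too large a
  -- range to lie in `F`.
  obtain ⟨e, he⟩ := hρ (U.subtype ∘ₗ U.projectionOnto V hUV)
  have heU : ∀ u ∈ U, ρ e u = u := fun u hu => by
    rw [he]
    exact congrArg Subtype.val (Submodule.projectionOnto_apply_left hUV ⟨u, hu⟩)
  have heV : ∀ u ∈ V, ρ e u = 0 := fun u hu => by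
    rw [he]
    exact congrArg Subtype.val (Submodule.projectionOnto_apply_right hUV ⟨u, hu⟩)
  have hea : e • F.mkQ a ≠ 0 := fun h => by
    have h : (LinearMap.range (ρ (e * a))).FG := (Submodule.Quotient.mk_eq_zero F).mp h
    refine hU (h.of_le_of_isSemisimpleModule fun u hu => ?_)
    obtain ⟨s, rfl⟩ := hUN hu
    exact ⟨s, by rw [map_mul, Module.End.mul_apply, heU _ hu]⟩
  have hea' : (e • ⟨F.mkQ a, hqT⟩ : T) ≠ 0 := fun h => hea (congrArg Subtype.val h)
  -- Simplicity recovers `a` from `e * a` modulo `F`. But `a - b * (e * a)` agrees with `a` wherever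
  -- `a` takes values in `V`, so its range contains the other half.
  obtain ⟨b, hb⟩ := IsSimpleModule.toSpanSingleton_surjective A hea' ⟨F.mkQ a, hqT⟩
  have hb : b • e • F.mkQ a = F.mkQ a := congrArg Subtype.val hb
  have hf : (LinearMap.range (ρ (a - b * (e * a)))).FG :=
    (Submodule.Quotient.mk_eq_zero F).mp (by
      rw [← Submodule.mkQ_apply, map_sub, sub_eq_zero]
      exact hb.symm)
  refine hV (hf.of_le_of_isSemisimpleModule ?_)
  rintro _ ⟨⟨s, rfl⟩, hs⟩
  refine ⟨s, ?_⟩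
  rw [map_sub, map_mul, map_mul, LinearMap.sub_apply, Module.End.mul_apply, Module.End.mul_apply,
    heV _ hs, map_zero, sub_zero]

end EndomorphismRing

/-! ### Descending sequences of subspaces -/

section DualSpace

/-- If every linear form vanishes on some member of a descending sequence of subspaces, then the
sequence reaches zero. -/
theorem exists_eq_bot_of_forall_dual {K : Type u} [Field K] {V : Type v} [AddCommGroup V]
    [Module K V] {U : ℕ → Submodule K V} (hU : Antitone U)
    (h : ∀ f : Module.Dual K V, ∃ n, ∀ v ∈ U n, f v = 0) : ∃ n, U n = ⊥ := by
  by_contra! hne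
  by_cases hinf : ⨅ n, U n = ⊥
  -- With zero intersection, vectors lost at successive strict drops are linearly independent. A
  -- form equal to `1` on all of them vanishes on no `U n`.
  · have step : ∀ n, ∃ m, n < m ∧ ∃ v ∈ U n, v ∉ U m := fun n => by
      obtain ⟨v, hv, hv0⟩ := Submodule.exists_mem_ne_zero_of_ne_bot (hne n)
      by_contra! hall
      refine hv0 ((Submodule.mem_bot K).mp (hinf ▸ (Submodule.mem_iInf _).mpr fun m => ?_))
      rcases lt_or_ge n m with hm | hm
      · exact hall m hm v hv
      · exact hU hm hv
    choose g hg v hv hvg using step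
    let k : ℕ → ℕ := fun n => g^[n] 0
    have hk : ∀ n, k (n + 1) = g (k n) := fun n => Function.iterate_succ_apply' g n 0
    have hkm : StrictMono k := strictMono_nat_of_lt_succ fun n => hk n ▸ hg _
    have hli : LinearIndependent K fun n => v (k n) := by
      rw [linearIndependent_iff']
      intro s c hc i
      induction i using Nat.strong_induction_on with
      | _ i ih =>
        intro hi
        by_contra hci
        rw [← Finset.add_sum_erase s _ hi, add_eq_zero_iff_eq_neg] at hc
        have hmem : c i • v (k i) ∈ U (g (k i)) := by
          rw [hc, ← hk]
          refine neg_mem (Submodule.sum_mem _ fun j hj => ?_)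
          rw [Finset.mem_erase] at hj
          rcases lt_or_gt_of_ne hj.1 with hji | hji
          · rw [ih j hji hj.2, zero_smul]
            exact zero_mem _
          · exact Submodule.smul_mem _ _ (hU (hkm.monotone hji) (hv (k j)))
        exact hvg (k i) ((Submodule.smul_mem_iff _ hci).mp hmem)
    obtain ⟨f, hf⟩ : ∃ f : Module.Dual K V, ∀ n, f (v (k n)) = 1 := by
      obtain ⟨f, hf⟩ := LinearMap.exists_extend
        (Finsupp.linearCombination K (fun _ : ℕ => (1 : K)) ∘ₗ hli.repr)
      refine ⟨f, fun n => ?_⟩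
      have hn : v (k n) ∈ Submodule.span K (Set.range fun n => v (k n)) :=
        Submodule.subset_span ⟨n, rfl⟩
      have h := LinearMap.congr_fun hf ⟨v (k n), hn⟩
      rw [LinearMap.comp_apply, LinearMap.comp_apply, Submodule.subtype_apply,
        hli.repr_eq_single n ⟨v (k n), hn⟩ rfl] at h
      simpa using h
    obtain ⟨n, hn⟩ := h f
    have := hn _ (hU hkm.le_apply (hv (k n)))
    rw [hf] at this
    exact one_ne_zero this
  · obtain ⟨v, hv, hv0⟩ := Submodule.exists_mem_ne_zero_of_ne_bot hinf
    obtain ⟨f, hf⟩ := Module.Projective.exists_dual_ne_zero K hv0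
    obtain ⟨n, hn⟩ := h f
    exact hf (hn v ((Submodule.mem_iInf _).mp hv n))

end DualSpace

/-! ### Algebras with a predual bimodule -/

section Predual

open MulOpposite

/-- An `A`-bimodule `W` with a linear form `ε` is a predual of the algebra `A` if
`a ↦ (w ↦ ε (w • a))` identifies `A` with the dual space of `W`, and `W` is locally finite as a
right module. -/
structure IsPredual {K : Type u} {A : Type v} {W : Type w} [Field K] [Ring A] [AddCommGroup W]
    [Module K W] [Module A W] [Module Aᵐᵒᵖ W] (ε : Module.Dual K W) : Prop where
  ext : ∀ a b : A, (∀ w, ε (op a • w) = ε (op b • w)) → a = b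
  exists_eq : ∀ f : Module.Dual K W, ∃ a : A, ∀ w, f w = ε (op a • w)
  apply_smul : ∀ (a : A) (w : W), ε (a • w) = ε (op a • w)
  locally_finite : ∀ w : W, ∃ T : Submodule K W, T.FG ∧ ∀ a : A, op a • w ∈ T

namespace IsPredual

variable {K : Type u} {A : Type v} {W : Type w} [Field K] [Ring A] [AddCommGroup W]
  [Module K W] [Module A W] [Module Aᵐᵒᵖ W] {ε : Module.Dual K W}

theorem eq_zero (h : IsPredual (A := A) ε) {w : W} (hw : ∀ a : A, ε (op a • w) = 0) : w = 0 := by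
  by_contra hne
  obtain ⟨f, hf⟩ := Module.Projective.exists_dual_ne_zero K hne
  obtain ⟨a, ha⟩ := h.exists_eq f
  exact hf ((ha w).trans (hw a))

variable [Algebra K A] [IsScalarTower K Aᵐᵒᵖ W]

theorem fg_restrictScalars (h : IsPredual (A := A) ε) {N : Submodule Aᵐᵒᵖ W} (hN : N.FG) :
    (N.restrictScalars K).FG := by
  induction N, hN using Submodule.fg_induction with
  | singleton w =>
    obtain ⟨T, hT, hw⟩ := h.locally_finite w
    have : IsNoetherian K T := isNoetherian_of_fg_of_noetherian T hT
    refine isNoetherian_submodule.mp this _ fun v hv => ?_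
    obtain ⟨a, rfl⟩ := Submodule.mem_span_singleton.mp hv
    exact hw a.unop
  | sup N₁ N₂ _ _ h₁ h₂ =>
    rw [Submodule.restrictScalars_sup]
    exact h₁.sup h₂

/-- By local finiteness a nonzero cyclic submodule is finite-dimensional, so it contains a simple
submodule. -/
theorem exists_mem_moduleSocle (h : IsPredual (A := A) ε) {N : Submodule Aᵐᵒᵖ W} (hN : N ≠ ⊥) :
    ∃ w ∈ N, w ∈ moduleSocle Aᵐᵒᵖ W ∧ w ≠ 0 := by
  obtain ⟨w, hw, hw0⟩ := Submodule.exists_mem_ne_zero_of_ne_bot hN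
  let P := Submodule.span Aᵐᵒᵖ {w}
  have hP : Module.Finite K P :=
    Module.Finite.iff_fg.mpr (h.fg_restrictScalars (Submodule.fg_span_singleton w))
  have hPa : IsArtinian Aᵐᵒᵖ P := isArtinian_of_tower K inferInstance
  have hPn : Nontrivial P :=
    ⟨⟨w, Submodule.mem_span_singleton_self w⟩, 0, fun h0 => hw0 (congrArg Subtype.val h0)⟩
  obtain ⟨S, hS⟩ := IsAtomic.exists_atom (Submodule Aᵐᵒᵖ P)
  have hS' : IsSimpleModule Aᵐᵒᵖ S := isSimpleModule_iff_isAtom.mpr hS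
  obtain ⟨v, hv, hv0⟩ := Submodule.exists_mem_ne_zero_of_ne_bot hS.1
  refine ⟨v, ?_, map_moduleSocle_le P.subtype (Submodule.mem_map_of_mem
    (le_moduleSocle_of_isSemisimpleModule S hv)),
    fun h0 => hv0 (Subtype.ext h0)⟩
  exact (Submodule.span_singleton_le_iff_mem w N).mpr hw v.2

variable [SMulCommClass A Aᵐᵒᵖ W]

theorem smul_mem_moduleSocle (a : A) {w : W} (hw : w ∈ moduleSocle Aᵐᵒᵖ W) :
    a • w ∈ moduleSocle Aᵐᵒᵖ W :=
  map_moduleSocle_le (Module.toModuleEnd Aᵐᵒᵖ W a) (Submodule.mem_map_of_mem hw)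

/-- The Jacobson radical is the annihilator of the right socle of the predual. -/
theorem mem_jacobson_iff (h : IsPredual (A := A) ε) {a : A} :
    a ∈ Ring.jacobson A ↔ ∀ w ∈ moduleSocle Aᵐᵒᵖ W, ε (op a • w) = 0 := by
  refine ⟨fun ha w hw => by rw [op_smul_eq_zero_of_mem_moduleSocle ha hw, map_zero], fun ha => ?_⟩
  rw [← Ideal.jacobson_bot, Ideal.mem_jacobson_iff]
  intro r
  let T : W →ₗ[Aᵐᵒᵖ] W := Module.toModuleEnd Aᵐᵒᵖ W (r * a + 1)
  -- The kernel is a right submodule, so if nonzero it meets the socle. There `r * a` acts as zero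
  -- and `r * a + 1` as the identity.
  have hT : LinearMap.ker T = ⊥ := by
    by_contra hne
    obtain ⟨w, hw, hws, hw0⟩ := h.exists_mem_moduleSocle hne
    have hw : (r * a + 1) • w = 0 := hw
    have hra : (r * a) • w = 0 := h.eq_zero fun s => by
      rw [← smul_comm, h.apply_smul, op_mul, mul_smul]
      exact ha _ (Submodule.smul_mem _ _ (Submodule.smul_mem _ _ hws))
    rw [add_smul, hra, one_smul, zero_add] at hw
    exact hw0 hw
  -- Only a `K`-linear left inverse of `T` is needed: the element representing `ε ∘ₗ L` is a left
  -- inverse of `r * a + 1` in `A`.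
  obtain ⟨L, hL⟩ := LinearMap.exists_leftInverse_of_injective (T.restrictScalars K)
    (by rw [LinearMap.ker_restrictScalars, hT, Submodule.restrictScalars_bot])
  obtain ⟨c, hc⟩ := h.exists_eq (ε ∘ₗ L)
  refine ⟨c, ?_⟩
  have key : c * (r * a + 1) = 1 := h.ext _ _ fun w => by
    rw [op_mul, mul_smul, ← h.apply_smul, smul_comm, op_one, one_smul]
    have := hc (T w)
    rw [LinearMap.comp_apply] at this
    exact this.symm.trans (congrArg ε (LinearMap.congr_fun hL w))
  rw [Submodule.mem_bot, sub_eq_zero, ← key, mul_add, mul_one, mul_assoc]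

theorem finite_moduleSocle (h : IsPredual (A := A) ε) (hA : IsLeftSemiartinianRing A) :
    Module.Finite K (moduleSocle Aᵐᵒᵖ W) := by
  have := isSemisimpleModule_moduleSocle (R := Aᵐᵒᵖ) (M := W)
  let ρ : A →+* Module.End Aᵐᵒᵖ (moduleSocle Aᵐᵒᵖ W) :=
    { toFun := fun a => (Module.toModuleEnd Aᵐᵒᵖ W a).restrict
        fun _ hw => smul_mem_moduleSocle a hw
      map_one' := LinearMap.ext fun w => Subtype.ext (one_smul A (w : W))
      map_mul' := fun a b => LinearMap.ext fun w => Subtype.ext (mul_smul a b (w : W))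
      map_zero' := LinearMap.ext fun w => Subtype.ext (zero_smul A (w : W))
      map_add' := fun a b => LinearMap.ext fun w => Subtype.ext (add_smul a b (w : W)) }
  have hρ : Function.Surjective ρ := fun e => by
    -- The form `ε ∘ e` on the socle extends to `W` and so is given by some `a`. An element of `W`
    -- is determined by `ε` on its right multiples, so `a` acts on the socle as `e`.
    obtain ⟨f, hf⟩ := LinearMap.exists_extend (p := (moduleSocle Aᵐᵒᵖ W).restrictScalars K)
      (ε ∘ₗ ((moduleSocle Aᵐᵒᵖ W).subtype ∘ₗ e).restrictScalars K)
    obtain ⟨a, ha⟩ := h.exists_eq f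
    have hfe : ∀ w : moduleSocle Aᵐᵒᵖ W, f w = ε (e w) := fun w => LinearMap.congr_fun hf w
    refine ⟨a, LinearMap.ext fun w => Subtype.ext (sub_eq_zero.mp (h.eq_zero fun s => ?_))⟩
    change ε (op s • (a • (w : W) - e w)) = 0
    rw [smul_sub, ← smul_comm, map_sub, h.apply_smul, ← ha]
    have := hfe (op s • w)
    rw [map_smul] at this
    exact sub_eq_zero.mpr this
  have hfin := finite_of_isLeftSemiartinianRing_of_surjective_toEnd hA ρ hρ
  exact Module.Finite.iff_fg.mpr (h.fg_restrictScalars (Module.Finite.iff_fg.mp hfin))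

/-- Restricting forms to the finite-dimensional right socle has its kernel inside the radical. -/
theorem finite_quotient_jacobson (h : IsPredual (A := A) ε) (hA : IsLeftSemiartinianRing A) :
    Module.Finite K (A ⧸ Ring.jacobson A) := by
  have := h.finite_moduleSocle hA
  have hK : ∀ (c : K) (a : A) (w : W), op (c • a) • w = c • op a • w := fun c a w => by
    rw [op_smul, smul_assoc]
  let g : A →ₗ[K] Module.Dual K (moduleSocle Aᵐᵒᵖ W) :=
    { toFun := fun a =>
        { toFun := fun w => ε (op a • (w : W))
          map_add' := fun v w => by rw [Submodule.coe_add, smul_add, map_add]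
          map_smul' := fun c w => by
            rw [RingHom.id_apply, ← map_smul, Submodule.coe_smul_of_tower, smul_comm] }
      map_add' := fun a b => LinearMap.ext fun w =>
        (congrArg ε (add_smul (op a) (op b) (w : W))).trans (map_add ε _ _)
      map_smul' := fun c a => LinearMap.ext fun w =>
        (congrArg ε (hK c a w)).trans (map_smul ε _ _) }
  have hg : LinearMap.ker g ≤
      LinearMap.ker (Ideal.Quotient.mkₐ K (Ring.jacobson A)).toLinearMap := fun a ha =>
    Ideal.Quotient.eq_zero_iff_mem.mpr
      (h.mem_jacobson_iff.mpr fun w hw => LinearMap.congr_fun ha ⟨w, hw⟩)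
  have : Module.Finite K (A ⧸ LinearMap.ker g) :=
    Module.Finite.equiv g.quotKerEquivRange.symm
  refine Module.Finite.of_surjective ((LinearMap.ker g).liftQ _ hg) fun x => ?_
  obtain ⟨a, rfl⟩ := Ideal.Quotient.mk_surjective x
  exact ⟨Submodule.Quotient.mk a, rfl⟩

theorem isSemisimpleRing_quotient_jacobson (h : IsPredual (A := A) ε)
    (hA : IsLeftSemiartinianRing A) : IsSemisimpleRing (A ⧸ Ring.jacobson A) := by
  have := h.finite_quotient_jacobson hA
  have : IsArtinianRing (A ⧸ Ring.jacobson A) := IsArtinianRing.of_finite K _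
  exact IsArtinianRing.isSemisimpleRing_iff_jacobson.mpr (Ring.jacobson_quotient_jacobson A)

/-- Otherwise each `a` in `J` has `J ^ n * a * x = 0` for some `n`. Such `a` represent the forms on
`W / S`, so every form kills the image of some `x W J ^ n`. By `exists_eq_bot_of_forall_dual` some
`x W J ^ n` lies in `S`, and this forces `J ^ (n + 1) * x = 0`. -/
theorem exists_jacobson_mul (h : IsPredual (A := A) ε) {x : A}
    (hx : ∀ n : ℕ, ∃ y ∈ Ring.jacobson A ^ n, y * x ≠ 0) :
    ∃ a ∈ Ring.jacobson A, ∀ n : ℕ, ∃ y ∈ Ring.jacobson A ^ n, y * (a * x) ≠ 0 := by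
  by_contra! hall
  let S := (moduleSocle Aᵐᵒᵖ W).restrictScalars K
  let U : ℕ → Submodule K W := fun n =>
    Submodule.span K {v | ∃ y ∈ Ring.jacobson A ^ n, ∃ w : W, x • op y • w = v}
  have hU : Antitone fun n => (U n).map S.mkQ := antitone_nat_of_succ_le fun n =>
    Submodule.map_mono (Submodule.span_mono fun v ⟨y, hy, w, hv⟩ =>
      ⟨y, Ideal.pow_le_pow_right n.le_succ hy, w, hv⟩)
  obtain ⟨n, hn⟩ := exists_eq_bot_of_forall_dual hU fun f => by
    obtain ⟨a, ha⟩ := h.exists_eq (f ∘ₗ S.mkQ)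
    have haJ : a ∈ Ring.jacobson A := h.mem_jacobson_iff.mpr fun w hw => by
      rw [← ha, LinearMap.comp_apply, Submodule.mkQ_apply,
        (Submodule.Quotient.mk_eq_zero S).mpr hw, map_zero]
    obtain ⟨n, hn⟩ := hall a haJ
    refine ⟨n, ?_⟩
    suffices H : U n ≤ LinearMap.ker (f ∘ₗ S.mkQ) by
      rintro _ ⟨v, hv, rfl⟩
      exact H hv
    refine Submodule.span_le.mpr ?_
    rintro _ ⟨y, hy, w, rfl⟩
    change (f ∘ₗ S.mkQ) (x • op y • w) = 0
    rw [ha, ← smul_comm, h.apply_smul, smul_smul, smul_smul, ← op_mul, ← op_mul, hn y hy, op_zero,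
      zero_smul, map_zero]
  have hn : U n ≤ S := fun v hv => (Submodule.Quotient.mk_eq_zero S).mp
    ((Submodule.mem_bot K).mp (hn ▸ Submodule.mem_map_of_mem hv))
  obtain ⟨z, hz, hzx⟩ := hx (n + 1)
  refine hzx ?_
  clear hzx
  rw [Submodule.pow_succ] at hz
  induction hz using Submodule.mul_induction_on' with
  | mem_mul_mem y hy a ha =>
    refine h.ext _ _ fun w => ?_
    -- `ε (w y a x) = ε (x w y a)`, where `x w y` lies in the right socle and `a` in the radical.
    rw [op_zero, zero_smul, map_zero, mul_assoc, op_mul, op_mul, mul_smul, mul_smul,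
      ← h.apply_smul, smul_comm]
    exact h.mem_jacobson_iff.mp ha _ (hn (Submodule.subset_span ⟨y, hy, w, rfl⟩))
  | add y hy z hz h1 h2 => rw [add_mul, h1, h2, add_zero]

theorem isNilpotent_jacobson (h : IsPredual (A := A) ε) (hA : IsLeftSemiartinianRing A) :
    IsNilpotent (Ring.jacobson A) := by
  by_contra hJ
  refine hA.not_of_jacobson_smul
    (P := fun x : A => ∀ n : ℕ, ∃ y ∈ Ring.jacobson A ^ n, y * x ≠ 0) (fun h0 => ?_)
    (fun x hx => h.exists_jacobson_mul hx) 1 fun n => ?_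
  · obtain ⟨y, -, hy⟩ := h0 0
    exact hy (mul_zero y)
  · obtain ⟨y, hy, hy0⟩ := Submodule.exists_mem_ne_zero_of_ne_bot fun h0 => hJ ⟨n, h0⟩
    exact ⟨y, hy, by rwa [mul_one]⟩

/-- The left and right socles of the predual have the same annihilator. -/
theorem mem_jacobson_iff_left (h : IsPredual (A := A) ε)
    (hs : IsSemisimpleRing (A ⧸ Ring.jacobson A)) {a : A} :
    a ∈ Ring.jacobson A ↔ ∀ w ∈ moduleSocle A W, ε (op a • w) = 0 := by
  refine ⟨fun ha w hw => ?_, fun ha => h.mem_jacobson_iff.mpr fun w hw => ha w ?_⟩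
  · rw [← h.apply_smul, smul_eq_zero_of_mem_moduleSocle ha hw, map_zero]
  -- The radical also kills the right socle from the left, so the right socle is contained in the
  -- left one.
  · refine mem_moduleSocle_of_forall_smul_eq_zero (Ring.jacobson A) fun j hj =>
      h.eq_zero fun s => ?_
    rw [← smul_comm, h.apply_smul]
    exact h.mem_jacobson_iff.mp hj _ (Submodule.smul_mem _ _ hw)

end IsPredual

end Predual

/-! ### A coalgebra as predual of its dual algebra -/

section CoalgebraPredual

open MulOpposite

variable (K : Type u) [Field K] (C : Type v) [AddCommGroup C] [Module K C] [Coalgebra K C]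

/-- The linear map `c ↦ c · f = ∑ f c₁ • c₂`. -/
noncomputable def dualRightAction (f : C →ₗ[K] K) : C →ₗ[K] C :=
  (TensorProduct.lid K C).toLinearMap ∘ₗ f.rTensor C ∘ₗ Coalgebra.comul

variable {K C} in
theorem dualRightAction_apply {ι : Type*} {c : C} (r : Coalgebra.Repr K c ι) (f : C →ₗ[K] K) :
    dualRightAction K C f c = ∑ i ∈ r.index, f (r.left i) • r.right i := by
  simp [dualRightAction, ← r.eq]

/-- `C`, as a left comodule over itself, is a right module over its dual algebra, with
`c · f = ∑ f c₁ • c₂`. -/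
noncomputable instance dualRightModule : Module (DualAlgebra K C)ᵐᵒᵖ C where
  smul f c := dualRightAction K C f.unop.ofConv c
  one_smul c := by
    change dualRightAction K C (Algebra.linearMap K K ∘ₗ Coalgebra.counit) c = c
    simp [dualRightAction]
  mul_smul f g c := by
    let r := Coalgebra.Repr.arbitrary K c
    let s := fun i => Coalgebra.Repr.arbitrary K (r.left i)
    let t := fun i => Coalgebra.Repr.arbitrary K (r.right i)
    change dualRightAction K C (g.unop * f.unop).ofConv c =
      dualRightAction K C f.unop.ofConv (dualRightAction K C g.unop.ofConv c)
    have key := congrArg ((TensorProduct.lid K C).toLinearMap ∘ₗ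
      TensorProduct.map g.unop.ofConv
        ((TensorProduct.lid K C).toLinearMap ∘ₗ f.unop.ofConv.rTensor C))
      (Coalgebra.sum_tmul_tmul_eq r s t)
    rw [dualRightAction_apply r, dualRightAction_apply r, map_sum]
    simp only [map_smul, fun i => dualRightAction_apply (t i) f.unop.ofConv]
    simp only [map_sum, LinearMap.comp_apply, TensorProduct.map_tmul,
      LinearMap.rTensor_tmul, LinearEquiv.coe_coe, TensorProduct.lid_tmul] at key
    simp only [fun i => (s i).convMul_apply g.unop f.unop, Finset.sum_smul, Finset.smul_sum,
      mul_smul]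
    exact key
  smul_zero f := map_zero _
  smul_add f := map_add _
  add_smul f g c := by
    change dualRightAction K C (f.unop.ofConv + g.unop.ofConv) c = _
    simp [dualRightAction, LinearMap.rTensor_add]
    rfl
  zero_smul c := by
    change dualRightAction K C 0 c = _
    simp [dualRightAction]

variable {K C}

theorem counit_dualAction (f : C →ₗ[K] K) (c : C) :
    Coalgebra.counit (R := K) (dualAction K C f c) = f c := by
  let r := Coalgebra.Repr.arbitrary K c
  rw [dualAction_apply r]
  conv_rhs => rw [← Coalgebra.sum_counit_smul (R := K) r]
  simp [mul_comm]

theorem counit_dualRightAction (f : C →ₗ[K] K) (c : C) :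
    Coalgebra.counit (R := K) (dualRightAction K C f c) = f c := by
  let r := Coalgebra.Repr.arbitrary K c
  rw [dualRightAction_apply r]
  have := congrArg ((TensorProduct.rid K K).toLinearMap ∘ₗ f.rTensor K)
    (Coalgebra.sum_tmul_counit_eq r)
  simpa [-Coalgebra.sum_tmul_counit_eq, mul_comm, map_sum, r] using this

instance : IsScalarTower K (DualAlgebra K C)ᵐᵒᵖ C where
  smul_assoc k f c := by
    change dualRightAction K C (k • f.unop.ofConv) c = k • dualRightAction K C f.unop.ofConv c
    simp [dualRightAction]

instance : SMulCommClass (DualAlgebra K C) (DualAlgebra K C)ᵐᵒᵖ C where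
  smul_comm f g c := by
    let r := Coalgebra.Repr.arbitrary K c
    let s := fun i => Coalgebra.Repr.arbitrary K (r.left i)
    let t := fun i => Coalgebra.Repr.arbitrary K (r.right i)
    change dualAction K C f.ofConv (dualRightAction K C g.unop.ofConv c) =
      dualRightAction K C g.unop.ofConv (dualAction K C f.ofConv c)
    have key := congrArg ((TensorProduct.lid K C).toLinearMap ∘ₗ
      TensorProduct.map g.unop.ofConv
        ((TensorProduct.rid K C).toLinearMap ∘ₗ f.ofConv.lTensor C))
      (Coalgebra.sum_tmul_tmul_eq r s t)
    rw [dualRightAction_apply r, dualAction_apply r, map_sum, map_sum]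
    simp only [map_smul, fun i => dualAction_apply (t i) f.ofConv,
      fun i => dualRightAction_apply (s i) g.unop.ofConv]
    simp only [map_sum, LinearMap.comp_apply, TensorProduct.map_tmul, LinearMap.lTensor_tmul,
      LinearEquiv.coe_coe, TensorProduct.lid_tmul, TensorProduct.rid_tmul] at key
    simp only [Finset.smul_sum]
    rw [← key]
    refine Finset.sum_congr rfl fun i _ => Finset.sum_congr rfl fun j _ => ?_
    exact smul_comm _ _ _

variable (K C) in
theorem isPredual_counit :
    IsPredual (A := DualAlgebra K C) (Coalgebra.counit : Module.Dual K C) where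
  ext f g h := by
    refine WithConv.ofConv_injective (LinearMap.ext fun c => ?_)
    rw [← counit_dualRightAction f.ofConv, ← counit_dualRightAction g.ofConv]
    exact h c
  exists_eq f := ⟨WithConv.toConv f, fun c => (counit_dualRightAction f c).symm⟩
  apply_smul f c := (counit_dualAction f.ofConv c).trans (counit_dualRightAction f.ofConv c).symm
  locally_finite c := by
    let r := Coalgebra.Repr.arbitrary K c
    -- Every `c · f` lies in the span of the finitely many right tensor factors of `Δ c`.
    refine ⟨Submodule.span K (r.right '' r.index), ?_, fun f => ?_⟩
    · exact Submodule.fg_span (r.index.finite_toSet.image _)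
    · change dualRightAction K C f.ofConv c ∈ _
      rw [dualRightAction_apply r]
      exact Submodule.sum_mem _ fun i hi =>
        Submodule.smul_mem _ _ (Submodule.subset_span ⟨i, hi, rfl⟩)

end CoalgebraPredual

/-! ### The predual of a profinite algebra -/

section InverseLimitPredual

open MulOpposite

variable {K : Type u} [Field K] {ι : Type x} {F : ι → Type w} [∀ i, Ring (F i)]
  [∀ i, Algebra K (F i)] {A : Type v} [Ring A] [Algebra K A] (π : ∀ i, A →ₐ[K] F i)

/-- The linear forms on an inverse limit that factor through one of the projections. -/
def factoringDual : Submodule K (Module.Dual K A) :=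
  ⨆ i, LinearMap.range (π i).toLinearMap.dualMap

variable {π}

theorem comp_mulLeft_mem_factoringDual (a : A) {φ : Module.Dual K A}
    (hφ : φ ∈ factoringDual π) : φ ∘ₗ LinearMap.mulLeft K a ∈ factoringDual π := by
  suffices H : factoringDual π ≤ (factoringDual π).comap (LinearMap.mulLeft K a).dualMap from H hφ
  refine iSup_le fun i => ?_
  rintro _ ⟨ψ, rfl⟩
  refine Submodule.mem_iSup_of_mem i ⟨ψ ∘ₗ LinearMap.mulLeft K (π i a), LinearMap.ext fun r => ?_⟩
  simp

theorem comp_mulRight_mem_factoringDual (a : A) {φ : Module.Dual K A}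
    (hφ : φ ∈ factoringDual π) : φ ∘ₗ LinearMap.mulRight K a ∈ factoringDual π := by
  suffices H : factoringDual π ≤ (factoringDual π).comap (LinearMap.mulRight K a).dualMap from H hφ
  refine iSup_le fun i => ?_
  rintro _ ⟨ψ, rfl⟩
  refine Submodule.mem_iSup_of_mem i ⟨ψ ∘ₗ LinearMap.mulRight K (π i a), LinearMap.ext fun r => ?_⟩
  simp

instance : Module A (factoringDual π) where
  smul a φ := ⟨φ ∘ₗ LinearMap.mulRight K a, comp_mulRight_mem_factoringDual a φ.2⟩
  one_smul φ := Subtype.ext (LinearMap.ext fun r => congrArg (φ : Module.Dual K A) (mul_one r))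
  mul_smul a b φ := Subtype.ext (LinearMap.ext fun r =>
    congrArg (φ : Module.Dual K A) (mul_assoc r a b).symm)
  smul_zero _ := rfl
  smul_add _ _ _ := rfl
  add_smul a b φ := Subtype.ext (LinearMap.ext fun r =>
    (congrArg (φ : Module.Dual K A) (mul_add r a b)).trans (map_add _ _ _))
  zero_smul φ := Subtype.ext (LinearMap.ext fun r =>
    (congrArg (φ : Module.Dual K A) (mul_zero r)).trans (map_zero _))

instance : Module Aᵐᵒᵖ (factoringDual π) where
  smul a φ := ⟨φ ∘ₗ LinearMap.mulLeft K a.unop, comp_mulLeft_mem_factoringDual a.unop φ.2⟩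
  one_smul φ := Subtype.ext (LinearMap.ext fun r => congrArg (φ : Module.Dual K A) (one_mul r))
  mul_smul a b φ := Subtype.ext (LinearMap.ext fun r =>
    congrArg (φ : Module.Dual K A) (mul_assoc b.unop a.unop r))
  smul_zero _ := rfl
  smul_add _ _ _ := rfl
  add_smul a b φ := Subtype.ext (LinearMap.ext fun r =>
    (congrArg (φ : Module.Dual K A) (add_mul a.unop b.unop r)).trans (map_add _ _ _))
  zero_smul φ := Subtype.ext (LinearMap.ext fun r =>
    (congrArg (φ : Module.Dual K A) (zero_mul r)).trans (map_zero _))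

instance : SMulCommClass A Aᵐᵒᵖ (factoringDual π) where
  smul_comm a b φ := Subtype.ext (LinearMap.ext fun r =>
    congrArg (φ : Module.Dual K A) (mul_assoc b.unop r a).symm)

instance : IsScalarTower K Aᵐᵒᵖ (factoringDual π) where
  smul_assoc k a φ := Subtype.ext (LinearMap.ext fun r =>
    (congrArg (φ : Module.Dual K A) (smul_mul_assoc k a.unop r)).trans (map_smul _ _ _))

variable (π) in
/-- Evaluation at `1` of the linear forms that factor through a projection. -/
def factoringDualEvalOne : Module.Dual K (factoringDual π) :=
  Module.Dual.eval K A 1 ∘ₗ (factoringDual π).subtype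

theorem factoringDualEvalOne_op_smul (a : A) (φ : factoringDual π) :
    factoringDualEvalOne π (op a • φ) = (φ : Module.Dual K A) a :=
  congrArg (φ : Module.Dual K A) (mul_one a)

theorem factoringDualEvalOne_smul (a : A) (φ : factoringDual π) :
    factoringDualEvalOne π (a • φ) = (φ : Module.Dual K A) a :=
  congrArg (φ : Module.Dual K A) (one_mul a)

variable (π) in
/-- Composition with a projection, as a map into the forms that factor through a projection. -/
def factoringDualOfDual (i : ι) : Module.Dual K (F i) →ₗ[K] factoringDual π :=
  (π i).toLinearMap.dualMap.codRestrict _ fun ψ => Submodule.mem_iSup_of_mem i ⟨ψ, rfl⟩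

/-- Directedness turns the supremum defining `factoringDual` into a union. -/
theorem IsInverseLimitAlgebra.exists_factoringDualOfDual_eq [Preorder ι] [IsDirectedOrder ι]
    [Nonempty ι] {t : ∀ ⦃i j : ι⦄, i ≤ j → F j →ₐ[K] F i} (h : IsInverseLimitAlgebra t π)
    (φ : factoringDual π) : ∃ i ψ, factoringDualOfDual π i ψ = φ := by
  have hmono : Monotone fun i => LinearMap.range (π i).toLinearMap.dualMap := by
    rintro i j hij _ ⟨ψ, rfl⟩
    exact ⟨ψ ∘ₗ (t hij).toLinearMap, LinearMap.ext fun a => congrArg ψ (h.compatible hij a)⟩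
  obtain ⟨i, ψ, hψ⟩ := (Submodule.mem_iSup_of_directed _ hmono.directed_le).mp φ.2
  exact ⟨i, ψ, Subtype.ext hψ⟩

/-- Each `F i` is its own bidual, so a form on the union of the images of the duals of the `F i`
amounts to a compatible family in the `F i`, that is, to an element of `A`. -/
theorem IsInverseLimitAlgebra.isPredual [Preorder ι] [IsDirectedOrder ι] [Nonempty ι]
    [∀ i, Module.Finite K (F i)] {t : ∀ ⦃i j : ι⦄, i ≤ j → F j →ₐ[K] F i}
    (h : IsInverseLimitAlgebra t π) : IsPredual (A := A) (W := factoringDual π) (factoringDualEvalOne π) where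
  ext a b hab := by
    refine (h.existsUnique (fun i => π i b) fun i j hij => h.compatible hij b).unique
      (fun i => ?_) fun _ => rfl
    rw [← sub_eq_zero, ← Module.forall_dual_apply_eq_zero_iff K]
    intro ψ
    have := hab (factoringDualOfDual π i ψ)
    rw [factoringDualEvalOne_op_smul, factoringDualEvalOne_op_smul] at this
    rw [map_sub, sub_eq_zero]
    exact this
  exists_eq f := by
    let y : ∀ i, F i := fun i =>
      (Module.evalEquiv K (F i)).symm (f ∘ₗ factoringDualOfDual π i)
    have hy : ∀ i ψ, ψ (y i) = f (factoringDualOfDual π i ψ) := fun i ψ =>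
      Module.apply_evalEquiv_symm_apply _ _ ψ _
    obtain ⟨a, ha, -⟩ := h.existsUnique y fun i j hij => by
      rw [← sub_eq_zero, ← Module.forall_dual_apply_eq_zero_iff K]
      intro ψ
      have hψ : factoringDualOfDual π j (ψ ∘ₗ (t hij).toLinearMap) = factoringDualOfDual π i ψ :=
        Subtype.ext (LinearMap.ext fun a => congrArg ψ (h.compatible hij a))
      rw [map_sub, sub_eq_zero, hy, ← hψ, ← hy]
      rfl
    refine ⟨a, fun φ => ?_⟩
    obtain ⟨i, ψ, rfl⟩ := h.exists_factoringDualOfDual_eq φ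
    rw [factoringDualEvalOne_op_smul, ← hy, ← ha]
    rfl
  apply_smul a φ := by rw [factoringDualEvalOne_smul, factoringDualEvalOne_op_smul]
  locally_finite φ := by
    obtain ⟨i, ψ, rfl⟩ := h.exists_factoringDualOfDual_eq φ
    refine ⟨LinearMap.range (factoringDualOfDual π i), Module.Finite.iff_fg.mp inferInstance,
      fun a => ⟨ψ ∘ₗ LinearMap.mulLeft K (π i a), Subtype.ext (LinearMap.ext fun r => ?_)⟩⟩
    exact congrArg ψ (map_mul (π i) a r).symm

end InverseLimitPredual

/-! ### The coradical filtration and the main theorem -/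

theorem hasFiniteCoradicalFiltration_of_isNilpotent_jacobson {K : Type u} [Field K] {C : Type v}
    [AddCommGroup C] [Module K C] [Coalgebra K C]
    (h : IsNilpotent (Ring.jacobson (DualAlgebra K C)))
    (hs : IsSemisimpleRing (DualAlgebra K C ⧸ Ring.jacobson (DualAlgebra K C))) :
    HasFiniteCoradicalFiltration K C := by
  obtain ⟨n, hn⟩ := h
  have := loewySeries_eq_top_of_pow_eq_bot (M := C) (Ring.jacobson (DualAlgebra K C)) hn
  -- `J ^ n = ⊥` already gives `L_n = C`, and `C_n` is the next term `L_{n+1}`.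
  exact ⟨n, top_le_iff.mp (this ▸ loewySeries_mono le_self_add)⟩

theorem coradicalFiltration_zero (K : Type u) [Field K] (C : Type v) [AddCommGroup C] [Module K C]
    [Coalgebra K C] : coradicalFiltration K C 0 = moduleSocle (DualAlgebra K C) C := by
  refine le_antisymm (fun c hc => ?_) fun c hc => ?_
  · rw [coradicalFiltration, Nat.cast_zero, loewySeries_add_one, Submodule.mem_comap] at hc
    have hbot : loewySeries (DualAlgebra K C) C 0 ≤ ⊥ := (loewySeries_zero _ _).le
    -- The quotient by `L_0 = 0` is only isomorphic to `C`, so the socle is carried across by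
    -- homomorphisms.
    have := map_moduleSocle_le ((loewySeries (DualAlgebra K C) C 0).liftQ LinearMap.id
      (by rwa [LinearMap.ker_id])) (Submodule.mem_map_of_mem hc)
    simpa using this
  · rw [coradicalFiltration, Nat.cast_zero, loewySeries_add_one]
    exact map_moduleSocle_le _ (Submodule.mem_map_of_mem hc)

/-- Part one: coalgebras `C` whose dual algebra is left semiartinian. Part two: left semiartinian
profinite algebras, given as inverse limits of directed systems of finite-dimensional algebras. -/
theorem theorem1p3 {K : Type u} [Field K] :
    (∀ (C : Type v) [AddCommGroup C] [Module K C] [Coalgebra K C],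
      IsLeftSemiartinianRing (DualAlgebra K C) →
        HasFiniteCoradicalFiltration K C ∧
        (∀ f : DualAlgebra K C, f ∈ Ring.jacobson (DualAlgebra K C) ↔
          ∀ c ∈ coradicalFiltration K C 0, f.ofConv c = 0) ∧
        IsNilpotent (Ring.jacobson (DualAlgebra K C)) ∧
        Module.Finite K (DualAlgebra K C ⧸ Ring.jacobson (DualAlgebra K C)) ∧
        IsSemisimpleRing (DualAlgebra K C ⧸ Ring.jacobson (DualAlgebra K C)) ∧
        IsRightSemiartinianRing (DualAlgebra K C)) ∧
    (∀ (ι : Type x) [Preorder ι] [IsDirectedOrder ι] [Nonempty ι]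
      (F : ι → Type w) [∀ i, Ring (F i)] [∀ i, Algebra K (F i)] [∀ i, Module.Finite K (F i)]
      (t : ∀ ⦃i j : ι⦄, i ≤ j → F j →ₐ[K] F i) [InverseSystem (fun _ _ h => t h)]
      (A : Type y) [Ring A] [Algebra K A] (π : ∀ i, A →ₐ[K] F i),
      IsInverseLimitAlgebra t π → IsLeftSemiartinianRing A →
        IsNilpotent (Ring.jacobson A) ∧
        Module.Finite K (A ⧸ Ring.jacobson A) ∧
        IsSemisimpleRing (A ⧸ Ring.jacobson A) ∧
        IsRightSemiartinianRing A) := by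
  refine ⟨fun C _ _ _ hC => ?_, fun ι _ _ _ F _ _ _ t _ A _ _ π hπ hA => ?_⟩
  · have h := isPredual_counit K C
    have hs := h.isSemisimpleRing_quotient_jacobson hC
    have hn := h.isNilpotent_jacobson hC
    refine ⟨hasFiniteCoradicalFiltration_of_isNilpotent_jacobson hn hs, fun f => ?_, hn,
      h.finite_quotient_jacobson hC, hs, isRightSemiartinianRing_of_isNilpotent_jacobson hn hs⟩
    rw [h.mem_jacobson_iff_left hs, coradicalFiltration_zero]
    exact forall₂_congr fun c _ => by rw [← counit_dualRightAction f.ofConv]; rfl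
  · have h := hπ.isPredual
    have hs := h.isSemisimpleRing_quotient_jacobson hA
    have hn := h.isNilpotent_jacobson hA
    exact ⟨hn, h.finite_quotient_jacobson hA, hs,
      isRightSemiartinianRing_of_isNilpotent_jacobson hn hs⟩
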